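/- Let $n\ge 1$ and $\varepsilon\in(0,1/(2n)]$. An $n\times n$ doubly stochastic real matrix $M$ is called $\varepsilon$-domestic if there are no two subsets $X\ne Y$ of $\{1,\dots,n\}$ with $|X|=|Y|$ and $\sum_{i\in X,\,j\in Y}M[i,j]>(1-\varepsilon)|X|$; let $\mathcal{D}_{n,\varepsilon}$ be the set of all $\varepsilon$-domestic $n\times n$ matrices. For a set $\mathcal{M}$ of $n\times n$ real matrices, let $\langle\mathcal{M}\rangle$ be the semigroup generated by $\mathcal{M}$ together with the identity matrix, i.e. the set of all finite products, including the empty one, of elements of $\mathcal{M}$. Then for every finite subset $\mathcal{M}\subset\mathcal{D}_{n,\varepsilon}$, the closure $\overline{\langle\mathcal{M}\rangle}$ in the space of $n\times n$ real matrices, which is a topological semigroup under matrix multiplication, is finitely generated (there is a finite set $\mathcal{F}$ of matrices with $\overline{\langle\mathcal{M}\rangle}=\langle\mathcal{F}\rangle$), hence countable, and it is profinite, i.e. isomorphic as a topological semigroup to a projective limit of finite discrete semigroups over a directed index set. -/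

import Mathlib

/-- The set of `n × n` `ε`-domestic matrices: the doubly stochastic matrices `M` for which there are
no two distinct index sets `X`, `Y` of the same size with
`∑_{i ∈ X, j ∈ Y} M i j > (1 - ε) * |X|`. -/
def domesticMatrices (n : ℕ) (ε : ℝ) : Set (Matrix (Fin n) (Fin n) ℝ) :=
  {M | M ∈ doublyStochastic ℝ (Fin n) ∧
    ¬ ∃ X Y : Finset (Fin n), X ≠ Y ∧ X.card = Y.card ∧
      ∑ i ∈ X, ∑ j ∈ Y, M i j > (1 - ε) * (X.card : ℝ)}

universe u

/-- A projective system of finite discrete semigroups indexed by a nonempty directed preorder.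
Semigroups are nonempty. -/
structure FiniteSemigroupSystem where
  /-- the index set -/
  Index : Type u
  [preorder : Preorder Index]
  nonempty_index : Nonempty Index
  directed : ∀ i j : Index, ∃ k : Index, i ≤ k ∧ j ≤ k
  /-- the finite semigroups -/
  obj : Index → Type u
  [semigroup : ∀ i, Semigroup (obj i)]
  [topology : ∀ i, TopologicalSpace (obj i)]
  discrete : ∀ i, DiscreteTopology (obj i)
  finite_obj : ∀ i, Finite (obj i)
  nonempty_obj : ∀ i, Nonempty (obj i)
  /-- the connecting homomorphisms -/
  map : ∀ {i j : Index}, i ≤ j → (obj j →ₙ* obj i)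
  map_id : ∀ (i : Index) (x : obj i), map (le_refl i) x = x
  map_comp : ∀ {i j k : Index} (hij : i ≤ j) (hjk : j ≤ k) (x : obj k),
    map hij (map hjk x) = map (hij.trans hjk) x

attribute [instance] FiniteSemigroupSystem.preorder FiniteSemigroupSystem.semigroup
  FiniteSemigroupSystem.topology

/-- The projective limit: the compatible families, as a subsemigroup of the product. Its topology
is the one induced by the product topology. -/
def FiniteSemigroupSystem.limit (F : FiniteSemigroupSystem.{u}) :
    Subsemigroup (∀ i, F.obj i) where
  carrier := {x | ∀ (i j : F.Index) (h : i ≤ j), F.map h (x j) = x i}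
  mul_mem' := by
    intro a b ha hb i j h
    rw [Pi.mul_apply, map_mul, ha i j h, hb i j h, Pi.mul_apply]

/-- A topological semigroup is profinite if it is isomorphic, algebraically and topologically, to a
projective limit of finite discrete semigroups. -/
def IsProfiniteSemigroup (S : Type u) [Semigroup S] [TopologicalSpace S] : Prop :=
  ∃ F : FiniteSemigroupSystem.{u}, Nonempty (S ≃ₜ* F.limit)

/-! A domestic matrix acts on Euclidean space as a nonexpansive map that strictly shortens every
vector it moves: equality of norms forces every variance in `sum_sq_sub_sum_sq_mulVec` to vanish,
and domesticity then identifies the level sets of `x` and `M *ᵥ x`.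

Let `B` be a finite set of such operators, `V` its common fixed space and `P` the orthogonal
projection onto `V`. By compactness, words using all letters of `B` contract the complement of `V`
by a uniform factor `c < 1` (`exists_norm_sub_starProjection_le`). Cut each word into blocks that
use all letters, plus an incomplete remainder. A limit of words with unboundedly many blocks is `P`;
a limit of words with a fixed number of blocks splits into limits over fewer letters, to which
induction applies. Hence the closure is generated by `B` and the projections for the subsets of `B`
(`topologicalClosure_submonoidClosure_eq`).

The closure is therefore countable, and it is compact because it consists of doubly stochastic
matrices. A countable compact Hausdorff space is totally separated, and the syntactic congruences of
clopen sets then separate points by finite discrete quotients. -/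

open Set Filter Topology

open scoped Pointwise

/-- The products of words whose set of letters is exactly `B`. -/
def productsWithContent {M : Type*} [Monoid M] (B : Set M) : Set M :=
  {T | ∃ l : List M, (∀ a, a ∈ l ↔ a ∈ B) ∧ l.prod = T}

/-! ### Factorizations of words by content -/

section Words

variable {M : Type*} [Monoid M] {B : Set M}

theorem productsWithContent_subset_closure (B : Set M) :
    productsWithContent B ⊆ Submonoid.closure B := by
  rintro _ ⟨l, hl, rfl⟩
  exact Submonoid.list_prod_mem _ fun a ha => Submonoid.subset_closure ((hl a).1 ha)

theorem productsWithContent_empty : productsWithContent (∅ : Set M) = {1} := by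
  ext T
  constructor
  · rintro ⟨l, hl, rfl⟩
    have : l = [] := List.eq_nil_iff_forall_not_mem.2 fun a ha => by simpa using (hl a).1 ha
    simp [this]
  · rintro rfl
    exact ⟨[], by simp, rfl⟩

theorem productsWithContent_nonempty (hB : B.Finite) : (productsWithContent B).Nonempty :=
  ⟨_, hB.toFinset.toList, by simp, rfl⟩

theorem mul_mem_productsWithContent {b T : M} (hb : b ∈ B)
    (hT : T ∈ productsWithContent (B \ {b})) : T * b ∈ productsWithContent B := by
  obtain ⟨l, hl, rfl⟩ := hT
  refine ⟨l ++ [b], fun a => ?_, by simp⟩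
  by_cases hab : a = b
  · simp [hab, hb]
  · simp [hl, hab]

/-- Reading from the right, `b` is the last letter to make its first appearance, so `b :: l₁` is the
shortest suffix containing all letters. -/
theorem List.exists_append_cons_of_ne_nil {α : Type*} {l : List α} (hl : l ≠ []) :
    ∃ b l₁ l₂, l = l₂ ++ b :: l₁ ∧ ∀ a, a ∈ l₁ ↔ a ∈ l ∧ a ≠ b := by
  induction l with
  | nil => exact absurd rfl hl
  | cons a l ih =>
    by_cases ha : a ∈ l
    · obtain ⟨b, l₁, l₂, h, h'⟩ := ih (List.ne_nil_of_mem ha)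
      refine ⟨b, l₁, a :: l₂, by simp [h], fun c => ?_⟩
      rw [h', List.mem_cons]
      constructor
      · exact fun h => ⟨Or.inr h.1, h.2⟩
      · rintro ⟨rfl | hc, hcb⟩
        · exact ⟨ha, hcb⟩
        · exact ⟨hc, hcb⟩
    · refine ⟨a, l, [], rfl, fun c => ?_⟩
      rw [List.mem_cons]
      constructor
      · exact fun hc => ⟨Or.inr hc, fun h => ha (h ▸ hc)⟩
      · rintro ⟨rfl | hc, hcb⟩
        · exact absurd rfl hcb
        · exact hc

/-- Cutting off the shortest suffix that contains all letters. -/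
theorem exists_mul_mul_of_mem_productsWithContent (hB : B.Nonempty) {T : M}
    (hT : T ∈ productsWithContent B) :
    ∃ b ∈ B, ∃ T₂ ∈ Submonoid.closure B, ∃ T₁ ∈ productsWithContent (B \ {b}),
      T = T₂ * b * T₁ := by
  obtain ⟨l, hl, rfl⟩ := hT
  obtain ⟨c, hc⟩ := hB
  obtain ⟨b, l₁, l₂, h, h'⟩ := List.exists_append_cons_of_ne_nil (List.ne_nil_of_mem ((hl c).2 hc))
  refine ⟨b, (hl b).1 (by simp [h]), l₂.prod, Submonoid.list_prod_mem _ fun a ha =>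
    Submonoid.subset_closure ((hl a).1 (by simp [h, ha])), l₁.prod, ⟨l₁, fun a => ?_, rfl⟩, ?_⟩
  · rw [h', hl]; rfl
  · simp [h, mul_assoc]

/-- The greedy factorization of a word over `B` into minimal factors containing all letters, and a
remainder in which some letter is missing. -/
theorem exists_pow_mul_of_mem_closure (hB : B.Nonempty) {T : M} (hT : T ∈ Submonoid.closure B) :
    ∃ m : ℕ, ∃ Q ∈ (⋃ b ∈ B, productsWithContent (B \ {b}) * {b}) ^ m,
      ∃ C, C ⊂ B ∧ ∃ R ∈ productsWithContent C, T = Q * R := by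
  induction hT using Submonoid.closure_induction_right with
  | one =>
    exact ⟨0, 1, by simp, ∅, hB.empty_ssubset, 1, by simp [productsWithContent_empty], by simp⟩
  | mul_right T hT b hb ih =>
    obtain ⟨m, Q, hQ, C, hC, R, hR, rfl⟩ := ih
    have hCB : insert b C ⊆ B := insert_subset hb hC.subset
    have hRb : R * b ∈ productsWithContent (insert b C) := by
      obtain ⟨l, hl, rfl⟩ := hR
      exact ⟨l ++ [b], fun a => by simp [hl, or_comm], by simp⟩
    -- If `b` is the one missing letter, it completes a block and the remainder restarts empty;
    -- otherwise the remainder absorbs `b`.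
    rcases hCB.eq_or_ssubset with h | h
    · have hbC : b ∉ C := fun hbC => hC.ne (by rw [← h, insert_eq_of_mem hbC])
      have hCb : C = B \ {b} := by rw [← h, insert_sdiff_self_of_notMem hbC]
      refine ⟨m + 1, Q * (R * b), ?_, ∅, hB.empty_ssubset, 1,
        by simp [productsWithContent_empty], by simp [mul_assoc]⟩
      rw [pow_succ]
      refine mul_mem_mul hQ (mem_iUnion₂.2 ⟨b, hb, mul_mem_mul (hCb ▸ hR) rfl⟩)
    · exact ⟨m, Q, hQ, _, h, R * b, hRb, mul_assoc _ _ _⟩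

end Words

theorem IsCompact.set_pow {M : Type*} [Monoid M] [TopologicalSpace M] [ContinuousMul M]
    {K : Set M} (hK : IsCompact K) (m : ℕ) : IsCompact (K ^ m) := by
  induction m with
  | zero => simp
  | succ m ih => rw [pow_succ]; exact ih.mul hK

/-! ### Paracontracting maps and orthogonal projections -/

section Paracontracting

variable {E : Type*} [NormedAddCommGroup E] [InnerProductSpace ℝ E]

/-- A nonexpansive map that strictly decreases the norm of every vector it moves. -/
def IsParacontracting (T : E →L[ℝ] E) : Prop :=
  ∀ x, ‖T x‖ ≤ ‖x‖ ∧ (‖T x‖ = ‖x‖ → T x = x)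

/-- The vectors fixed by all elements of `B`. -/
def commonFixedSpace (B : Set (E →L[ℝ] E)) : Submodule ℝ E where
  carrier := {x | ∀ T ∈ B, T x = x}
  add_mem' hx hy T hT := by rw [map_add, hx T hT, hy T hT]
  zero_mem' T _ := map_zero T
  smul_mem' c x hx T hT := by rw [map_smul, hx T hT]

theorem mem_commonFixedSpace {B : Set (E →L[ℝ] E)} {x : E} :
    x ∈ commonFixedSpace B ↔ ∀ T ∈ B, T x = x := Iff.rfl

theorem apply_eq_of_mem_submonoidClosure {B : Set (E →L[ℝ] E)} {T : E →L[ℝ] E}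
    (hT : T ∈ Submonoid.closure B) {x : E} (hx : x ∈ commonFixedSpace B) : T x = x := by
  induction hT using Submonoid.closure_induction with
  | mem T hT => exact hx T hT
  | one => rfl
  | mul S T _ _ hS hT => rw [mul_apply_eq_comp, hT, hS]

theorem norm_le_one_of_mem_submonoidClosure {B : Set (E →L[ℝ] E)}
    (hB : ∀ T ∈ B, IsParacontracting T) {T : E →L[ℝ] E} (hT : T ∈ Submonoid.closure B) :
    ‖T‖ ≤ 1 := by
  induction hT using Submonoid.closure_induction with
  | mem T hT =>
    exact T.opNorm_le_bound zero_le_one fun x => by rw [one_mul]; exact (hB T hT x).1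
  | one => exact ContinuousLinearMap.norm_id_le
  | mul S T _ _ hS hT =>
    exact (norm_mul_le S T).trans (mul_le_one₀ hS (norm_nonneg _) hT)

theorem norm_le_one_of_mem_closure {s : Set (E →L[ℝ] E)} (hs : ∀ T ∈ s, ‖T‖ ≤ 1)
    {T : E →L[ℝ] E} (hT : T ∈ closure s) : ‖T‖ ≤ 1 := by
  have : closure s ⊆ Metric.closedBall 0 1 :=
    closure_minimal (fun T hT => by simpa using hs T hT) Metric.isClosed_closedBall
  simpa using this hT

theorem apply_eq_of_mem_closure {s : Set (E →L[ℝ] E)} {x : E} (hs : ∀ T ∈ s, T x = x)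
    {T : E →L[ℝ] E} (hT : T ∈ closure s) : T x = x := by
  have : IsClosed {T : E →L[ℝ] E | T x = x} :=
    isClosed_eq (ContinuousLinearMap.apply ℝ E x).continuous continuous_const
  exact closure_minimal hs this hT

theorem norm_apply_le_of_norm_le_one {T : E →L[ℝ] E} (hT : ‖T‖ ≤ 1) (x : E) : ‖T x‖ ≤ ‖x‖ := by
  simpa using T.le_of_opNorm_le hT x

/-- A contraction commutes with the orthogonal projection onto a space that it fixes. -/
theorem starProjection_mul_eq_of_norm_le_one (V : Submodule ℝ E) [V.HasOrthogonalProjection]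
    [CompleteSpace E] {T : E →L[ℝ] E} (hT : ‖T‖ ≤ 1) (hV : ∀ v ∈ V, T v = v) :
    V.starProjection * T = V.starProjection := by
  -- The adjoint also fixes `V`: expanding `‖T†v - v‖²` gives `‖T†v‖² - 2⟪v, T v⟫ + ‖v‖²`, which is
  -- `‖T†v‖² - ‖v‖² ≤ 0`.
  have hadj : ∀ v ∈ V, ContinuousLinearMap.adjoint T v = v := by
    intro v hv
    have h1 : ‖ContinuousLinearMap.adjoint T v‖ ≤ ‖v‖ :=
      norm_apply_le_of_norm_le_one (by rwa [LinearIsometryEquiv.norm_map]) v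
    have h2 : ‖ContinuousLinearMap.adjoint T v - v‖ ^ 2 ≤ 0 := by
      rw [norm_sub_sq_real, ContinuousLinearMap.adjoint_inner_left, hV v hv,
        real_inner_self_eq_norm_sq]
      nlinarith [norm_nonneg (ContinuousLinearMap.adjoint T v), norm_nonneg v]
    have h3 : ‖ContinuousLinearMap.adjoint T v - v‖ = 0 := by
      have := sq_nonneg ‖ContinuousLinearMap.adjoint T v - v‖
      exact pow_eq_zero_iff (two_ne_zero) |>.1 (le_antisymm h2 this)
    exact sub_eq_zero.1 (norm_eq_zero.1 h3)
  ext x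
  rw [mul_apply_eq_comp]
  refine Submodule.eq_starProjection_of_mem_of_inner_eq_zero
    (Submodule.starProjection_apply_mem _ _) fun w hw => ?_
  have h := Submodule.starProjection_inner_eq_zero (K := V) x w hw
  rw [inner_sub_left] at h ⊢
  rw [← ContinuousLinearMap.adjoint_inner_right, hadj w hw]
  exact h

theorem mul_starProjection_eq (V : Submodule ℝ E) [V.HasOrthogonalProjection]
    {T : E →L[ℝ] E} (hV : ∀ v ∈ V, T v = v) : T * V.starProjection = V.starProjection := by
  ext x
  exact hV _ (Submodule.starProjection_apply_mem _ _)

end Paracontracting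

/-! ### Limits of products of paracontracting maps -/

section RandomProducts

variable {E : Type*} [NormedAddCommGroup E] [InnerProductSpace ℝ E] [FiniteDimensional ℝ E]
  {B : Set (E →L[ℝ] E)}

theorem isCompact_closure_productsWithContent (hB : ∀ T ∈ B, IsParacontracting T) :
    IsCompact (closure (productsWithContent B)) := by
  have := FiniteDimensional.proper ℝ (E →L[ℝ] E)
  refine (isCompact_closedBall (0 : E →L[ℝ] E) 1).of_isClosed_subset isClosed_closure
    fun T hT => ?_
  rw [mem_closedBall_zero_iff]
  exact norm_le_one_of_mem_closure (fun S hS => norm_le_one_of_mem_submonoidClosure hB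
    (productsWithContent_subset_closure B hS)) hT

/-- Induction on the number of letters. The factorization `T₂ * b * T₁` survives in the limit, and
no factor may shorten the vector. By induction `x` is fixed by all letters except possibly `b`,
hence by the limit of the `T₁`, so `b` preserves `‖x‖` and fixes `x`. -/
theorem mem_commonFixedSpace_of_norm_apply_eq (hfin : B.Finite)
    (hB : ∀ T ∈ B, IsParacontracting T) {L : E →L[ℝ] E}
    (hL : L ∈ closure (productsWithContent B)) {x : E} (hx : ‖L x‖ = ‖x‖) :
    x ∈ commonFixedSpace B := by
  induction h : B.ncard using Nat.strong_induction_on generalizing B L with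
  | _ k ih =>
  rcases B.eq_empty_or_nonempty with rfl | hne
  · exact fun T hT => absurd hT (notMem_empty T)
  have := FiniteDimensional.proper ℝ (E →L[ℝ] E)
  have hB' : ∀ b, ∀ T ∈ B \ {b}, IsParacontracting T := fun b T hT => hB T hT.1
  have hcpt : IsCompact (⋃ b ∈ B, Metric.closedBall (0 : E →L[ℝ] E) 1 * {b} *
      closure (productsWithContent (B \ {b}))) :=
    hfin.isCompact_biUnion fun b _ => ((isCompact_closedBall _ _).mul isCompact_singleton).mul
      (isCompact_closure_productsWithContent (hB' b))
  -- The right-hand side is compact, hence closed, so it suffices to factor actual words; of the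
  -- left factor only the norm bound is kept.
  have hsub : closure (productsWithContent B) ⊆ ⋃ b ∈ B, Metric.closedBall (0 : E →L[ℝ] E) 1 * {b} *
      closure (productsWithContent (B \ {b})) := by
    refine closure_minimal (fun T hT => ?_) hcpt.isClosed
    obtain ⟨b, hb, T₂, hT₂, T₁, hT₁, rfl⟩ := exists_mul_mul_of_mem_productsWithContent hne hT
    exact mem_iUnion₂.2 ⟨b, hb, mul_mem_mul (mul_mem_mul (mem_closedBall_zero_iff.2
      (norm_le_one_of_mem_submonoidClosure hB hT₂)) rfl) (subset_closure hT₁)⟩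
  obtain ⟨b, hb, T, ⟨L₂, hL₂, b', hb', rfl⟩, L₁, hL₁, rfl⟩ := mem_iUnion₂.1 (hsub hL)
  obtain rfl : b' = b := hb'
  have h₁ : ‖L₁‖ ≤ 1 := norm_le_one_of_mem_closure (fun S hS =>
    norm_le_one_of_mem_submonoidClosure (hB' b') (productsWithContent_subset_closure _ hS)) hL₁
  have hx' : ‖L₂ (b' (L₁ x))‖ = ‖x‖ := hx
  have e₁ := norm_apply_le_of_norm_le_one h₁ x
  have e₂ := (hB b' hb (L₁ x)).1
  have e₃ := norm_apply_le_of_norm_le_one (mem_closedBall_zero_iff.1 hL₂) (b' (L₁ x))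
  have hxV : x ∈ commonFixedSpace (B \ {b'}) :=
    ih _ (h ▸ ncard_sdiff_singleton_lt_of_mem hb hfin) (hfin.sdiff) (hB' b') hL₁
      (le_antisymm e₁ (by linarith)) rfl
  have hL₁x : L₁ x = x := apply_eq_of_mem_closure (fun S hS =>
    apply_eq_of_mem_submonoidClosure (productsWithContent_subset_closure _ hS) hxV) hL₁
  rw [hL₁x] at e₂ e₃ hx'
  intro T hT
  by_cases hTb : T = b'
  · rw [hTb]
    exact (hB b' hb x).2 (le_antisymm e₂ (by linarith))
  · exact hxV T ⟨hT, hTb⟩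

/-- Products of words containing all letters of `B` are uniformly closer to the projection onto the
common fixed space than `1`. -/
theorem exists_norm_sub_starProjection_le (hfin : B.Finite)
    (hB : ∀ T ∈ B, IsParacontracting T) :
    ∃ c : ℝ, 0 ≤ c ∧ c < 1 ∧ ∀ L ∈ productsWithContent B,
      ‖L - (commonFixedSpace B).starProjection‖ ≤ c := by
  have := FiniteDimensional.proper ℝ E
  set P := (commonFixedSpace B).starProjection with hP
  have hcpt := (isCompact_closure_productsWithContent hB).prod (isCompact_closedBall (0 : E) 1)
  have hcont : Continuous fun p : (E →L[ℝ] E) × E => ‖p.1 (p.2 - P p.2)‖ := by fun_prop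
  obtain ⟨⟨L₀, x₀⟩, ⟨hL₀, hx₀⟩, hmax⟩ := hcpt.exists_isMaxOn
    ((productsWithContent_nonempty hfin).closure.prod ⟨0, by simp⟩) hcont.continuousOn
  have hfix : ∀ L ∈ closure (productsWithContent B), ∀ v ∈ commonFixedSpace B, L v = v :=
    fun L hL v hv => apply_eq_of_mem_closure (fun S hS =>
      apply_eq_of_mem_submonoidClosure (productsWithContent_subset_closure _ hS) hv) hL
  refine ⟨‖L₀ (x₀ - P x₀)‖, norm_nonneg _, ?_, fun L hL => ?_⟩
  · have h₀ : ‖L₀‖ ≤ 1 := norm_le_one_of_mem_closure (fun S hS =>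
      norm_le_one_of_mem_submonoidClosure hB (productsWithContent_subset_closure _ hS)) hL₀
    have e₁ := norm_apply_le_of_norm_le_one h₀ (x₀ - P x₀)
    have e₂ : ‖x₀ - P x₀‖ ≤ ‖x₀‖ := by
      rw [← Submodule.starProjection_orthogonal_val]
      exact Submodule.norm_starProjection_apply_le _ _
    have e₃ : ‖x₀‖ ≤ 1 := mem_closedBall_zero_iff.1 hx₀
    -- If the maximum were at least `1`, then `L₀` would preserve the norm of `x₀ - P x₀`, which
    -- would lie in the fixed space and in its orthogonal complement, hence be zero.
    by_contra! hge
    have hmem := mem_commonFixedSpace_of_norm_apply_eq hfin hB hL₀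
      (le_antisymm e₁ (by linarith))
    have hzero : x₀ - P x₀ = 0 := by
      have := Submodule.sub_starProjection_mem_orthogonal (K := commonFixedSpace B) x₀
      exact (Submodule.disjoint_def.1 (commonFixedSpace B).orthogonal_disjoint) _ hmem this
    rw [hzero, map_zero, norm_zero] at hge
    linarith
  · refine ContinuousLinearMap.opNorm_le_of_unit_norm (norm_nonneg _) fun x hx => ?_
    have h := hmax (a := (L, x)) ⟨subset_closure hL, mem_closedBall_zero_iff.2 hx.le⟩
    have hPx : L (P x) = P x :=
      hfix L (subset_closure hL) _ (Submodule.starProjection_apply_mem _ _)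
    simpa [map_sub, hPx] using h

/-- Since `L * P`, `P * T` and `P * P` all equal `P`, the error is multiplicative: `L * T - P = (L -
P) * (T - P)`. -/
theorem norm_sub_starProjection_le_pow (hB : ∀ T ∈ B, IsParacontracting T) {c : ℝ}
    (hc : ∀ L ∈ productsWithContent B, ‖L - (commonFixedSpace B).starProjection‖ ≤ c) (m : ℕ) :
    ∀ L ∈ productsWithContent B ^ m, ‖L - (commonFixedSpace B).starProjection‖ ≤ c ^ m := by
  set P := (commonFixedSpace B).starProjection with hP
  induction m with
  | zero =>
    intro L hL
    rw [pow_zero, Set.mem_one] at hL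
    rw [hL, ← Submodule.starProjection_orthogonal', pow_zero]
    exact Submodule.starProjection_norm_le _
  | succ m ih =>
    rintro _ hL
    rw [pow_succ] at hL
    obtain ⟨L, hL, T, hT, rfl⟩ := hL
    have hT' := productsWithContent_subset_closure _ hT
    have hL' : L ∈ Submonoid.closure B := 
      Submonoid.pow_subset (productsWithContent_subset_closure B) hL
    have e₁ : L * P = P := mul_starProjection_eq _ fun v hv => apply_eq_of_mem_submonoidClosure hL' hv
    have e₂ : P * T = P := starProjection_mul_eq_of_norm_le_one _
      (norm_le_one_of_mem_submonoidClosure hB hT') fun v hv => apply_eq_of_mem_submonoidClosure hT' hv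
    have e₃ : P * P = P := (commonFixedSpace B).isIdempotentElem_starProjection
    have e : L * T - P = (L - P) * (T - P) := by
      rw [sub_mul, mul_sub, mul_sub, e₁, e₂, e₃]; abel
    change ‖L * T - P‖ ≤ _
    rw [e, pow_succ]
    exact (norm_mul_le _ _).trans (mul_le_mul (ih L hL) (hc T hT) (norm_nonneg _)
      ((norm_nonneg _).trans (ih L hL)))

theorem starProjection_mem_closure (hfin : B.Finite) (hB : ∀ T ∈ B, IsParacontracting T) :
    (commonFixedSpace B).starProjection ∈ closure (Submonoid.closure B : Set (E →L[ℝ] E)) := by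
  obtain ⟨c, hc₀, hc₁, hc⟩ := exists_norm_sub_starProjection_le hfin hB
  obtain ⟨T, hT⟩ := productsWithContent_nonempty hfin
  refine mem_closure_of_tendsto (b := atTop) (f := fun m : ℕ => T ^ m) ?_
    (Eventually.of_forall fun m => pow_mem (productsWithContent_subset_closure B hT) m)
  rw [tendsto_iff_norm_sub_tendsto_zero]
  exact squeeze_zero (fun _ => norm_nonneg _) (fun m => norm_sub_starProjection_le_pow hB hc m _
    (Set.pow_mem_pow hT)) (tendsto_pow_atTop_nhds_zero_of_lt_one hc₀ hc₁)

/-- Induction on the number of letters, with a dichotomy: either `L` is a limit of words with a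
fixed number of blocks, and compactness lets the limit be taken factor by factor, or the number of
blocks is unbounded near `L` and `L = P`. -/
theorem mem_submonoidClosure_of_mem_closure_productsWithContent (hfin : B.Finite)
    (hB : ∀ T ∈ B, IsParacontracting T) {L : E →L[ℝ] E}
    (hL : L ∈ closure (productsWithContent B)) :
    L ∈ Submonoid.closure (B ∪ (fun C => (commonFixedSpace C).starProjection) '' 𝒫 B) := by
  induction h : B.ncard using Nat.strong_induction_on generalizing B L with
  | _ k ih =>
  rcases B.eq_empty_or_nonempty with rfl | hne
  · rw [productsWithContent_empty, closure_singleton, mem_singleton_iff] at hL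
    rw [hL]
    exact one_mem _
  set P := (commonFixedSpace B).starProjection with hP
  set G := Submonoid.closure (B ∪ (fun C => (commonFixedSpace C).starProjection) '' 𝒫 B) with hG
  have hih : ∀ C, C ⊂ B → closure (productsWithContent C) ⊆ G := by
    intro C hC T hT
    have := ih _ (h ▸ ncard_lt_ncard hC hfin) (hfin.subset hC.subset)
      (fun T hT => hB T (hC.subset hT)) hT rfl
    exact Submonoid.closure_mono (union_subset_union hC.subset
      (image_mono (powerset_mono.2 hC.subset))) this
  have hssub : ∀ b ∈ B, B \ {b} ⊂ B := fun b hb =>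
    ⟨sdiff_subset, fun h => (h hb).2 rfl⟩
  -- `Q m` consists of products of `m` complete blocks and an incomplete remainder.
  set Q : ℕ → Set (E →L[ℝ] E) := fun m =>
    (⋃ b ∈ B, productsWithContent (B \ {b}) * {b}) ^ m *
      ⋃ C ∈ {C | C ⊂ B}, productsWithContent C with hQ
  have hcover : productsWithContent B ⊆ ⋃ m, Q m := by
    intro T hT
    obtain ⟨m, S, hS, C, hC, R, hR, rfl⟩ :=
      exists_pow_mul_of_mem_closure hne (productsWithContent_subset_closure B hT)
    exact mem_iUnion.2 ⟨m, mul_mem_mul hS (mem_iUnion₂.2 ⟨C, hC, hR⟩)⟩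
  by_cases hm : ∃ m, L ∈ closure (Q m)
  · obtain ⟨m, hm⟩ := hm
    set K := (⋃ b ∈ B, closure (productsWithContent (B \ {b})) * {b}) ^ m *
      ⋃ C ∈ {C | C ⊂ B}, closure (productsWithContent C) with hK
    have hKcpt : IsCompact K := by
      refine (IsCompact.set_pow (hfin.isCompact_biUnion fun b hb =>
        (isCompact_closure_productsWithContent fun T hT => hB T hT.1).mul isCompact_singleton)
        m).mul ?_
      exact (hfin.finite_subsets.subset fun C (hC : C ⊂ B) => hC.subset).isCompact_biUnion
        fun C (hC : C ⊂ B) => isCompact_closure_productsWithContent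
          fun T hT => hB T (hC.subset hT)
    have hKG : K ⊆ G := by
      rintro _ ⟨S, hS, R, hR, rfl⟩
      refine mul_mem (Submonoid.pow_subset ?_ hS) ?_
      · refine iUnion₂_subset fun b hb => ?_
        rintro _ ⟨T, hT, b', hb', rfl⟩
        rw [mem_singleton_iff.1 hb']
        exact mul_mem (hih _ (hssub b hb) hT) (Submonoid.subset_closure (Or.inl hb))
      · obtain ⟨C, hC, hR⟩ := mem_iUnion₂.1 hR
        exact hih C hC hR
    refine hKG (closure_minimal ?_ hKcpt.isClosed hm)
    exact mul_subset_mul (pow_subset_pow_left (iUnion₂_mono fun b hb =>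
      mul_subset_mul_right subset_closure)) (iUnion₂_mono fun C hC => subset_closure)
  · push Not at hm
    obtain ⟨c, hc₀, hc₁, hc⟩ := exists_norm_sub_starProjection_le hfin hB
    have hQP : ∀ m, ∀ T ∈ Q m, ‖T - P‖ ≤ c ^ m := by
      rintro m _ ⟨S, hS, R, hR, rfl⟩
      obtain ⟨C, hC, hR⟩ := mem_iUnion₂.1 hR
      have hR' : R ∈ Submonoid.closure B := Submonoid.closure_mono hC.subset
        (productsWithContent_subset_closure C hR)
      have hS' : S ∈ productsWithContent B ^ m := by
        refine pow_subset_pow_left (iUnion₂_subset fun b hb => ?_) hS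
        rintro _ ⟨T, hT, b', hb', rfl⟩
        rw [mem_singleton_iff.1 hb']
        exact mul_mem_productsWithContent hb hT
      have hRn := norm_le_one_of_mem_submonoidClosure hB hR'
      have e : S * R - P = (S - P) * R := by
        rw [sub_mul, starProjection_mul_eq_of_norm_le_one _ hRn
          fun v hv => apply_eq_of_mem_submonoidClosure hR' hv]
      change ‖S * R - P‖ ≤ _
      rw [e]
      have h1 := norm_sub_starProjection_le_pow hB hc m S hS'
      calc ‖(S - P) * R‖ ≤ ‖S - P‖ * ‖R‖ := norm_mul_le _ _
        _ ≤ c ^ m * 1 := mul_le_mul h1 hRn (norm_nonneg _) (by positivity)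
        _ = c ^ m := mul_one _
    have hLP : ∀ k, ‖L - P‖ ≤ c ^ k := by
      intro k
      -- Closure commutes with the finite union over `m < k`, which `hm` excludes, so only words
      -- with at least `k` blocks accumulate at `L`.
      have hsplit : productsWithContent B ⊆ (⋃ m ∈ Finset.range k, Q m) ∪ ⋃ m ≥ k, Q m := by
        intro T hT
        obtain ⟨m, hm⟩ := mem_iUnion.1 (hcover hT)
        rcases lt_or_ge m k with hmk | hmk
        · exact Or.inl (mem_iUnion₂.2 ⟨m, Finset.mem_range.2 hmk, hm⟩)
        · exact Or.inr (mem_iUnion₂.2 ⟨m, hmk, hm⟩)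
      have hLm := closure_mono hsplit hL
      rw [closure_union, Finset.closure_biUnion] at hLm
      rcases hLm with hLm | hLm
      · obtain ⟨m, -, hLm⟩ := mem_iUnion₂.1 hLm
        exact absurd hLm (hm m)
      · have : closure (⋃ m ≥ k, Q m) ⊆ Metric.closedBall P (c ^ k) := by
          refine closure_minimal (iUnion₂_subset fun m hmk T hT => ?_) Metric.isClosed_closedBall
          rw [mem_closedBall_iff_norm]
          exact (hQP m T hT).trans (pow_le_pow_of_le_one hc₀ hc₁.le hmk)
        exact mem_closedBall_iff_norm.1 (this hLm)
    have h0 : ‖L - P‖ ≤ 0 :=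
      ge_of_tendsto' (tendsto_pow_atTop_nhds_zero_of_lt_one hc₀ hc₁) hLP
    rw [sub_eq_zero.1 (norm_le_zero_iff.1 h0)]
    exact Submonoid.subset_closure (Or.inr ⟨B, Subset.rfl, rfl⟩)

/-- The closed semigroup generated by finitely many paracontracting maps is generated by these maps
and the projections onto the common fixed spaces of subfamilies. -/
theorem topologicalClosure_submonoidClosure_eq (hfin : B.Finite)
    (hB : ∀ T ∈ B, IsParacontracting T) :
    (Submonoid.closure B).topologicalClosure =
      Submonoid.closure (B ∪ (fun C => (commonFixedSpace C).starProjection) '' 𝒫 B) := by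
  refine le_antisymm (fun L hL => ?_) (Submonoid.closure_le.2 (union_subset ?_ ?_))
  · have hcover : (Submonoid.closure B : Set (E →L[ℝ] E)) ⊆ ⋃ C ∈ 𝒫 B, productsWithContent C := by
      intro T hT
      obtain ⟨l, hl, rfl⟩ := Submonoid.exists_list_of_mem_closure hT
      exact mem_iUnion₂.2 ⟨{a | a ∈ l}, hl, l, fun a => Iff.rfl, rfl⟩
    have hL' := closure_mono hcover hL
    rw [hfin.powerset.closure_biUnion] at hL'
    obtain ⟨C, hC, hLC⟩ := mem_iUnion₂.1 hL'
    exact Submonoid.closure_mono (union_subset_union hC (image_mono (powerset_mono.2 hC)))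
      (mem_submonoidClosure_of_mem_closure_productsWithContent (hfin.subset hC)
        (fun T hT => hB T (hC hT)) hLC)
  · exact Submonoid.subset_closure.trans (Submonoid.le_topologicalClosure _)
  · rintro _ ⟨C, hC, rfl⟩
    exact closure_mono (Submonoid.closure_mono hC)
      (starProjection_mem_closure (hfin.subset hC) fun T hT => hB T (hC hT))

theorem topologicalClosure_submonoidClosure_fg (hfin : B.Finite)
    (hB : ∀ T ∈ B, IsParacontracting T) : (Submonoid.closure B).topologicalClosure.FG := by
  rw [topologicalClosure_submonoidClosure_eq hfin hB, Submonoid.fg_iff]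
  exact ⟨_, rfl, hfin.union (hfin.powerset.image _)⟩

end RandomProducts

/-! ### Compact totally separated monoids are profinite -/

section Profinite

variable {S : Type u} [Semigroup S] [TopologicalSpace S]

/-- The syntactic congruence of a subset of a monoid. -/
def syntacticCon {S : Type*} [Monoid S] (C : Set S) : Con S where
  r x y := ∀ s t, s * x * t ∈ C ↔ s * y * t ∈ C
  iseqv := ⟨fun _ _ _ => Iff.rfl, fun h s t => (h s t).symm,
    fun h h' s t => (h s t).trans (h' s t)⟩
  mul' := by
    intro w x y z hwx hyz s t
    have h1 := hwx s (y * t)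
    have h2 := hyz (s * x) t
    simp only [mul_assoc] at h1 h2 ⊢
    exact h1.trans h2

/-- For clopen `C` the condition at a single pair `(s, t)` is open in the middle factor; compactness
of `S × S` and the tube lemma make it hold for all pairs on one neighbourhood. -/
theorem isOpen_syntacticCon {S : Type*} [Monoid S] [TopologicalSpace S] [ContinuousMul S]
    [CompactSpace S] {C : Set S} (hC : IsClopen C) (x : S) :
    IsOpen {y | syntacticCon C x y} := by
  rw [isOpen_iff_mem_nhds]
  intro y hxy
  have hU : IsOpen {p : (S × S) × S | p.1.1 * y * p.1.2 ∈ C ↔ p.1.1 * p.2 * p.1.2 ∈ C} := by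
    have h1 : IsClopen {p : (S × S) × S | p.1.1 * y * p.1.2 ∈ C} :=
      hC.preimage (by fun_prop)
    have h2 : IsClopen {p : (S × S) × S | p.1.1 * p.2 * p.1.2 ∈ C} :=
      hC.preimage (by fun_prop)
    have : {p : (S × S) × S | p.1.1 * y * p.1.2 ∈ C ↔ p.1.1 * p.2 * p.1.2 ∈ C} =
        ({p : (S × S) × S | p.1.1 * y * p.1.2 ∈ C} ∩ {p | p.1.1 * p.2 * p.1.2 ∈ C}) ∪
        ({p : (S × S) × S | p.1.1 * y * p.1.2 ∈ C}ᶜ ∩ {p | p.1.1 * p.2 * p.1.2 ∈ C}ᶜ) := by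
      ext p
      simp only [mem_ofPred_eq, mem_union, mem_inter_iff, mem_compl_iff]
      tauto
    rw [this]
    exact ((h1.inter h2).union (h1.compl.inter h2.compl)).isOpen
  obtain ⟨V, W, _, hW, hV, hyW, hVW⟩ := generalized_tube_lemma (isCompact_univ (X := S × S))
    (isCompact_singleton (x := y)) hU (by rintro ⟨p, z⟩ ⟨-, rfl⟩; exact Iff.rfl)
  filter_upwards [hW.mem_nhds (hyW rfl)] with z hz s t
  exact (hxy s t).trans (hVW (a := ((s, t), z)) ⟨hV (mem_univ _), hz⟩)

/-- The congruences with open classes. -/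
def OpenCon (S : Type*) [Semigroup S] [TopologicalSpace S] : Type _ :=
  {c : Con S // ∀ x, IsOpen {y | c x y}}

/-- Open congruences are ordered by reverse inclusion. -/
instance (S : Type*) [Semigroup S] [TopologicalSpace S] : Preorder (OpenCon S) where
  le c d := d.1 ≤ c.1
  le_refl c := le_refl c.1
  le_trans _ _ _ h h' := le_trans h' h

theorem OpenCon.finite_quotient [CompactSpace S] (c : OpenCon S) : Finite c.1.Quotient := by
  obtain ⟨t, ht⟩ := isCompact_univ.elim_finite_subcover (fun x : S => {y | c.1 x y}) c.2
    fun x _ => mem_iUnion.2 ⟨x, c.1.refl x⟩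
  refine Set.finite_univ_iff.1 ((t.finite_toSet.image (fun x : S => (x : c.1.Quotient))).subset ?_)
  intro q _
  induction q using Con.induction_on with
  | H y =>
    obtain ⟨x, hx, hxy⟩ := mem_iUnion₂.1 (ht (mem_univ y))
    exact ⟨x, hx, (Con.eq c.1).2 hxy⟩

/-- The projective system of the quotients by open congruences. -/
def openConSystem (S : Type u) [Semigroup S] [TopologicalSpace S] [CompactSpace S] [Nonempty S] :
    FiniteSemigroupSystem.{u} where
  Index := OpenCon S
  nonempty_index := ⟨⟨⊤, fun x => isOpen_univ⟩⟩
  directed c d := ⟨⟨c.1 ⊓ d.1, fun x => (c.2 x).inter (d.2 x)⟩,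
    inf_le_left (a := c.1) (b := d.1), inf_le_right (a := c.1) (b := d.1)⟩
  obj c := c.1.Quotient
  topology _ := ⊥
  discrete _ := @DiscreteTopology.mk _ ⊥ rfl
  finite_obj c := c.finite_quotient
  nonempty_obj _ := ⟨((Classical.arbitrary S : S) : Con.Quotient _)⟩
  map {c d} h :=
    { toFun := fun q => Con.liftOn q (fun x => (x : c.1.Quotient))
        fun x y hxy => (Con.eq c.1).2 ((show d.1 ≤ c.1 from h) hxy)
      map_mul' := by
        intro x y
        induction x, y using Con.induction_on₂ with
        | H x y => rfl }
  map_id c x := by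
    induction x using Con.induction_on with
    | H x => rfl
  map_comp _ _ x := by
    induction x using Con.induction_on with
    | H x => rfl

/-- The canonical map from a semigroup to the limit of its quotients by open congruences. -/
def toOpenConLimit (S : Type u) [Semigroup S] [TopologicalSpace S] [CompactSpace S] [Nonempty S] :
    S →ₙ* (openConSystem S).limit where
  toFun x := ⟨fun c => (x : c.1.Quotient), fun _ _ _ => rfl⟩
  map_mul' _ _ := rfl

theorem continuous_toOpenConLimit [CompactSpace S] [Nonempty S] :
    Continuous (toOpenConLimit S) := by
  refine Continuous.subtype_mk (continuous_pi fun c => ?_) _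
  have : DiscreteTopology ((openConSystem S).obj c) := (openConSystem S).discrete c
  refine continuous_discrete_rng.2 fun q => ?_
  induction q using Con.induction_on with
  | H x =>
    convert c.2 x using 1
    ext y
    exact (Con.eq c.1).trans ⟨c.1.symm, c.1.symm⟩

/-- The sets of points matching one coordinate of a compatible family are nonempty, closed and
directed, so by compactness they have a common point. -/
theorem surjective_toOpenConLimit [CompactSpace S] [Nonempty S] :
    Function.Surjective (toOpenConLimit S) := by
  intro p
  have hcl : ∀ c : (openConSystem S).Index, IsClosed {y : S | (toOpenConLimit S y).1 c = p.1 c} := by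
    intro c
    have : DiscreteTopology ((openConSystem S).obj c) := (openConSystem S).discrete c
    have hc : Continuous fun y : S => (toOpenConLimit S y).1 c :=
      (continuous_apply c).comp (continuous_subtype_val.comp continuous_toOpenConLimit)
    exact (isClosed_discrete {p.1 c}).preimage hc
  have hne : (⋂ c : (openConSystem S).Index, {y : S | (toOpenConLimit S y).1 c = p.1 c}).Nonempty := by
    have : Nonempty (openConSystem S).Index := (openConSystem S).nonempty_index
    refine IsCompact.nonempty_iInter_of_directed_nonempty_isCompact_isClosed _ ?_ ?_
      (fun c => (hcl c).isCompact) hcl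
    · intro c d
      obtain ⟨e, hce, hde⟩ := (openConSystem S).directed c d
      refine ⟨e, fun y hy => ?_, fun y hy => ?_⟩
      · have := p.2 c e hce
        rw [← hy] at this
        exact this
      · have := p.2 d e hde
        rw [← hy] at this
        exact this
    · intro c
      obtain ⟨y, hy⟩ := Quotient.exists_rep (p.1 c)
      exact ⟨y, hy⟩
  obtain ⟨x, hx⟩ := hne
  exact ⟨x, Subtype.ext (funext fun c => mem_iInter.1 hx c)⟩

/-- The syntactic congruence of a clopen set separating two points distinguishes them already in the
context `s = t = 1`. -/
theorem injective_toOpenConLimit {S : Type u} [Monoid S] [TopologicalSpace S] [ContinuousMul S]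
    [CompactSpace S] [TotallySeparatedSpace S] : Function.Injective (toOpenConLimit S) := by
  intro x y hxy
  by_contra hne
  obtain ⟨C, hC, hxC, hyC⟩ := exists_isClopen_of_totally_separated hne
  have h := congrFun (congrArg Subtype.val hxy) ⟨syntacticCon C, isOpen_syntacticCon hC⟩
  have h' := (Con.eq (syntacticCon C)).1 h 1 1
  rw [one_mul, mul_one, one_mul, mul_one] at h'
  exact hyC (h'.1 hxC)

/-- A compact totally separated topological monoid is profinite. -/
theorem isProfiniteSemigroup_of_totallySeparated {S : Type u} [Monoid S] [TopologicalSpace S]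
    [ContinuousMul S] [CompactSpace S] [TotallySeparatedSpace S] : IsProfiniteSemigroup S := by
  refine ⟨openConSystem S, ⟨?_⟩⟩
  have (c : (openConSystem S).Index) : DiscreteTopology ((openConSystem S).obj c) := (openConSystem S).discrete c
  have : T2Space (openConSystem S).limit := inferInstanceAs
    (T2Space {x : ∀ c, (openConSystem S).obj c // x ∈ (openConSystem S).limit})
  let e : S ≃ (openConSystem S).limit :=
    Equiv.ofBijective (toOpenConLimit S) ⟨injective_toOpenConLimit, surjective_toOpenConLimit⟩
  let h := Continuous.homeoOfEquivCompactToT2 (f := e) continuous_toOpenConLimit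
  exact { MulEquiv.mk e (toOpenConLimit S).map_mul with
    continuous_toFun := h.continuous
    continuous_invFun := h.symm.continuous }

end Profinite

/-! ### Domestic matrices as paracontracting maps -/

section DoublyStochastic

open Matrix

variable {n : ℕ} {M : Matrix (Fin n) (Fin n) ℝ}

/-- The loss of the sum of squares under a doubly stochastic matrix is a sum of variances. -/
theorem sum_sq_sub_sum_sq_mulVec (hM : M ∈ doublyStochastic ℝ (Fin n)) (x : Fin n → ℝ) :
    ∑ i, x i ^ 2 - ∑ i, (M *ᵥ x) i ^ 2 = ∑ i, ∑ j, M i j * (x j - (M *ᵥ x) i) ^ 2 := by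
  have h1 : ∑ i, x i ^ 2 = ∑ i, ∑ j, M i j * x j ^ 2 := by
    rw [Finset.sum_comm]
    refine Finset.sum_congr rfl fun j _ => ?_
    rw [← Finset.sum_mul, sum_col_of_mem_doublyStochastic hM, one_mul]
  rw [h1, ← Finset.sum_sub_distrib]
  refine Finset.sum_congr rfl fun i _ => ?_
  have h2 : ∑ j, M i j * x j = (M *ᵥ x) i := rfl
  generalize (M *ᵥ x) i = y at h2 ⊢
  have h3 : ∑ j, M i j * (x j - y) ^ 2 =
      ∑ j, M i j * x j ^ 2 - 2 * y * ∑ j, M i j * x j + y ^ 2 * ∑ j, M i j := by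
    rw [Finset.mul_sum, Finset.mul_sum, ← Finset.sum_sub_distrib, ← Finset.sum_add_distrib]
    exact Finset.sum_congr rfl fun j _ => by ring
  rw [h3, h2, sum_row_of_mem_doublyStochastic hM]
  ring

theorem sum_sq_mulVec_le (hM : M ∈ doublyStochastic ℝ (Fin n)) (x : Fin n → ℝ) :
    ∑ i, (M *ᵥ x) i ^ 2 ≤ ∑ i, x i ^ 2 := by
  rw [← sub_nonneg, sum_sq_sub_sum_sq_mulVec hM]
  exact Finset.sum_nonneg fun i _ => Finset.sum_nonneg fun j _ =>
    mul_nonneg (nonneg_of_mem_doublyStochastic hM) (sq_nonneg _)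

/-- No variance is lost, so `M i j ≠ 0` forces `x j = y i`. The block on the level sets `X` of `y`
and `Y` of `x` at the same value thus contains all the mass of its rows and columns. Summing both
ways gives `|X| = |Y|`, and a block of mass `|X|` contradicts domesticity unless `X = Y`. -/
theorem mulVec_eq_of_sum_sq_eq {ε : ℝ} (hε : 0 < ε) (hM : M ∈ domesticMatrices n ε)
    {x : Fin n → ℝ} (hx : ∑ i, (M *ᵥ x) i ^ 2 = ∑ i, x i ^ 2) : M *ᵥ x = x := by
  obtain ⟨hM, hdom⟩ := hM
  set y := M *ᵥ x with hy
  have hnn : ∀ i j, 0 ≤ M i j * (x j - y i) ^ 2 := fun i j =>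
    mul_nonneg (nonneg_of_mem_doublyStochastic hM) (sq_nonneg _)
  have hsum : ∑ i, ∑ j, M i j * (x j - y i) ^ 2 = 0 := by
    rw [← sum_sq_sub_sum_sq_mulVec hM, ← hy, hx, sub_self]
  have hzero : ∀ i j, M i j = 0 ∨ x j = y i := by
    intro i j
    have h1 := (Finset.sum_eq_zero_iff_of_nonneg fun i _ =>
      Finset.sum_nonneg fun j _ => hnn i j).1 hsum i (Finset.mem_univ i)
    have h2 := (Finset.sum_eq_zero_iff_of_nonneg fun j _ => hnn i j).1 h1 j (Finset.mem_univ j)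
    exact (mul_eq_zero.1 h2).imp_right fun h => sub_eq_zero.1 (pow_eq_zero_iff two_ne_zero |>.1 h)
  have hlevel : ∀ t : ℝ, Finset.univ.filter (fun i => y i = t) =
      Finset.univ.filter (fun j => x j = t) := by
    intro t
    set X := Finset.univ.filter (fun i => y i = t) with hX
    set Y := Finset.univ.filter (fun j => x j = t) with hY
    have hrow : ∑ i ∈ X, ∑ j ∈ Y, M i j = X.card := by
      rw [Finset.card_eq_sum_ones, Nat.cast_sum, Nat.cast_one]
      refine Finset.sum_congr rfl fun i hi => ?_
      rw [← sum_row_of_mem_doublyStochastic hM i]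
      refine Finset.sum_subset (Finset.subset_univ _) fun j _ hj => (hzero i j).resolve_right ?_
      rw [(Finset.mem_filter.1 hi).2]
      exact fun h => hj (Finset.mem_filter.2 ⟨Finset.mem_univ _, h⟩)
    have hcol : ∑ i ∈ X, ∑ j ∈ Y, M i j = Y.card := by
      refine Finset.sum_comm.trans ?_
      rw [Finset.card_eq_sum_ones, Nat.cast_sum, Nat.cast_one]
      refine Finset.sum_congr rfl fun j hj => ?_
      rw [← sum_col_of_mem_doublyStochastic hM j]
      refine Finset.sum_subset (Finset.subset_univ _) fun i _ hi => (hzero i j).resolve_right ?_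
      rw [(Finset.mem_filter.1 hj).2]
      exact fun h => hi (Finset.mem_filter.2 ⟨Finset.mem_univ _, h.symm⟩)
    have hcard : X.card = Y.card := by exact_mod_cast hrow.symm.trans hcol
    by_contra hne
    refine hdom ⟨X, Y, hne, hcard, ?_⟩
    -- Two empty level sets would coincide; positivity makes `|X| > (1 - ε) * |X|` strict.
    have hpos : 0 < X.card := by
      rw [Nat.pos_iff_ne_zero]
      intro h0
      exact hne ((Finset.card_eq_zero.1 h0).trans (Finset.card_eq_zero.1 (hcard ▸ h0)).symm)
    have hpos' : (0 : ℝ) < X.card := by exact_mod_cast hpos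
    rw [hrow]
    nlinarith [mul_pos hε hpos']
  funext i
  have : i ∈ Finset.univ.filter (fun j => x j = y i) := by
    rw [← hlevel]
    simp
  exact ((Finset.mem_filter.1 this).2).symm

theorem isParacontracting_toEuclideanCLM {ε : ℝ} (hε : 0 < ε) (hM : M ∈ domesticMatrices n ε) :
    IsParacontracting (toEuclideanCLM (n := Fin n) (𝕜 := ℝ) M) := by
  intro x
  have e₁ : ∀ z : EuclideanSpace ℝ (Fin n), ‖z‖ ^ 2 = ∑ i, z.ofLp i ^ 2 :=
    EuclideanSpace.real_norm_sq_eq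
  refine ⟨?_, fun h => ?_⟩
  · refine le_of_sq_le_sq ?_ (norm_nonneg _)
    rw [e₁, e₁]
    exact sum_sq_mulVec_le hM.1 _
  · have h' := congrArg (· ^ 2) h
    simp only [e₁] at h'
    exact WithLp.ofLp_injective 2 (mulVec_eq_of_sum_sq_eq hε hM h')

theorem isCompact_doublyStochastic (n : ℕ) :
    IsCompact (doublyStochastic ℝ (Fin n) : Set (Matrix (Fin n) (Fin n) ℝ)) := by
  have hbox : IsCompact (Set.pi univ fun _ : Fin n => Set.pi univ fun _ : Fin n =>
      Icc (0 : ℝ) 1) :=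
    isCompact_univ_pi fun _ => isCompact_univ_pi fun _ => isCompact_Icc
  refine hbox.of_isClosed_subset ?_ fun M hM i _ j _ =>
    ⟨nonneg_of_mem_doublyStochastic hM, le_one_of_mem_doublyStochastic hM⟩
  have : (doublyStochastic ℝ (Fin n) : Set (Matrix (Fin n) (Fin n) ℝ)) =
      {M | (∀ i j, 0 ≤ M i j) ∧ (∀ i, ∑ j, M i j = 1) ∧ ∀ j, ∑ i, M i j = 1} := by
    ext M
    exact mem_doublyStochastic_iff_sum
  rw [this]
  simp only [ofPred_and, ofPred_forall]
  refine (isClosed_iInter fun i => isClosed_iInter fun j => ?_).inter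
    ((isClosed_iInter fun i => ?_).inter (isClosed_iInter fun j => ?_))
  · exact isClosed_le continuous_const (by fun_prop)
  · exact isClosed_eq (by fun_prop) continuous_const
  · exact isClosed_eq (by fun_prop) continuous_const

theorem fg_topologicalClosure_of_subset_domesticMatrices {ε : ℝ} (hε : 0 < ε)
    {𝓜 : Set (Matrix (Fin n) (Fin n) ℝ)} (hfin : 𝓜.Finite) (hsub : 𝓜 ⊆ domesticMatrices n ε) :
    (Submonoid.closure 𝓜).topologicalClosure.FG := by
  let e := (toEuclideanCLM (n := Fin n) (𝕜 := ℝ)).toAlgEquiv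
  let e' := e.toLinearEquiv.toContinuousLinearEquiv
  have hfg := topologicalClosure_submonoidClosure_fg (B := e '' 𝓜) (hfin.image _)
    (by rintro _ ⟨M, hM, rfl⟩; exact isParacontracting_toEuclideanCLM hε (hsub hM))
  -- The algebra isomorphism between matrices and operators is a homeomorphism by finite
  -- dimensionality, so it commutes with closure.
  have hmap : (Submonoid.closure 𝓜).topologicalClosure =
      (Submonoid.closure (e '' 𝓜)).topologicalClosure.map e.symm.toRingEquiv.toMonoidHom := by
    apply SetLike.coe_injective
    have h1 : (Submonoid.closure (e '' 𝓜) : Set _) = e' '' (Submonoid.closure 𝓜 : Set _) := by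
      have := MonoidHom.map_mclosure e.toRingEquiv.toMonoidHom 𝓜
      exact (congrArg SetLike.coe this).symm
    have h2 : closure (Submonoid.closure (e '' 𝓜) : Set _) =
        e' '' closure (Submonoid.closure 𝓜 : Set _) := by
      rw [h1]
      exact (e'.toHomeomorph.image_closure _).symm
    change closure (Submonoid.closure 𝓜 : Set _) =
      e'.symm '' closure (Submonoid.closure (e '' 𝓜) : Set _)
    rw [h2]
    exact (e'.toEquiv.symm_image_image _).symm
  rw [hmap]
  exact hfg.map _

end DoublyStochastic

/-! ### Countability and conclusion -/

theorem Submonoid.FG.countable {M : Type*} [Monoid M] {S : Submonoid M} (hS : S.FG) :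
    (S : Set M).Countable := by
  obtain ⟨F, rfl, hF⟩ := (Submonoid.fg_iff S).1 hS
  have : Countable F := hF.countable
  refine (Set.countable_range fun l : List F => (l.map Subtype.val).prod).mono fun x hx => ?_
  obtain ⟨l, hl, rfl⟩ := Submonoid.exists_list_of_mem_closure hx
  lift l to List F using hl
  exact ⟨l, rfl⟩

theorem mainTheorem6 (n : ℕ) (hn : 0 < n) (ε : ℝ) (hε : ε ∈ Set.Ioc (0 : ℝ) (1 / (2 * (n : ℝ))))
    (𝓜 : Set (Matrix (Fin n) (Fin n) ℝ)) (hfin : 𝓜.Finite) (hsub : 𝓜 ⊆ domesticMatrices n ε) :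
    (Submonoid.closure 𝓜).topologicalClosure.FG ∧
      (closure (Submonoid.closure 𝓜 : Set (Matrix (Fin n) (Fin n) ℝ))).Countable ∧
      IsProfiniteSemigroup (Submonoid.closure 𝓜).topologicalClosure := by
  have hfg := fg_topologicalClosure_of_subset_domesticMatrices hε.1 hfin hsub
  have hct : (closure (Submonoid.closure 𝓜 : Set (Matrix (Fin n) (Fin n) ℝ))).Countable :=
    hfg.countable
  have hcpt : IsCompact (closure (Submonoid.closure 𝓜 : Set (Matrix (Fin n) (Fin n) ℝ))) :=
    (isCompact_doublyStochastic n).closure_of_subset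
      (Submonoid.closure_le.2 fun M hM => (hsub hM).1)
  have : CompactSpace (Submonoid.closure 𝓜).topologicalClosure := isCompact_iff_compactSpace.1 hcpt
  have : Countable (Submonoid.closure 𝓜).topologicalClosure := hct.to_subtype
  -- On a countable space a continuous function to `[0, 1]` separating two points omits a value
  -- strictly between `0` and `1`, and cutting there gives a clopen set.
  have : TotallySeparatedSpace (Submonoid.closure 𝓜).topologicalClosure := inferInstance
  exact ⟨hfg, hct, isProfiniteSemigroup_of_totallySeparated⟩
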